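/- Let $\mathcal I$ be a finite non-empty alphabet, $\beta = |\mathcal I| + 1$, and let $\$$, $\&$ be two extra symbols marking the start and the end of a sequence. A dataset $D$ is a finite multiset of sequences, each of the form $s = \$x_1\cdots x_m\&$ or (open-ended, e.g. after truncation) $s=\$x_1\cdots x_m$, with $x_i\in\mathcal I$. The length of a sequence counts $\&$ (if present) but not $\$$. Two datasets are neighboring if one is obtained by inserting one sequence into the other. Consider the (infinite) $\beta$-ary prediction suffix tree: each node $v$ carries a predictor string $\mathrm{dom}(v)$ over $\mathcal I\cup\{\$\}$, the root carries the empty string, and the $\beta$ children of a node are obtained by adding one symbol of $\mathcal I\cup\{\$\}$ at the beginning of its string; a node whose string begins with $\$$ cannot be split. For $x\in\mathcal I\cup\{\&\}$ let $\mathrm{hist}(v)[x]$ be the number of occurrences of $\mathrm{dom}(v)$ in the sequences of $D$ that are immediately followed by $x$, and put $$c(v)=\|\mathrm{hist}(v)\|_1-\max_{x\in\mathcal I\cup\{\&\}}\mathrm{hist}(v)[x],\qquad b(v)=\max\{\theta-\delta,\; c(v)-\mathrm{depth}(v)\cdot\delta\}.$$ The modified PrivTree algorithm, with parameters $\lambda$,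 $\theta\in\mathbb R$ and $\delta$, starts from the root and visits each created node $v$ once; it draws independent Laplace noise $\mathrm{Lap}(\lambda)$ (density $\frac1{2\lambda}e^{-|y|/\lambda}$), and, if $v$ can be split and $b(v)+\mathrm{Lap}(\lambda)>\theta$, it splits $v$, i.e. creates all its children. Its output is the resulting tree $\mathcal T$ (the predictor strings of all created nodes), without scores and histograms. Theorem. Let $\varepsilon>0$, $l^\top\in\mathbb N$ and $\theta\in\mathbb R$. Suppose that $$\lambda\ \ge\ \frac{2\beta-1}{\beta-1}\cdot\frac{l^\top}{\varepsilon}\qquad\text{and}\qquad \delta=\lambda\ln\beta .$$ Then the modified PrivTree algorithm is $\varepsilon$-differentially private on datasets whose sequences all have length at most $l^\top$: for any two neighboring such datasets $D,D'$ and any measurable set $S$ of outputs (in particular $S=\{\mathcal T\}$ for any single tree $\mathcal T$), $$\Pr[D\to S]\ \le\ e^{\varepsilon}\,\Pr[D'\to S].$$ (If $\lambda = 0$, which the hypotheses allow only when $l^\top=0$, $\mathrm{Lap}(0)$ is read as no noise.) -/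

import Mathlib

open MeasureTheory

noncomputable section

namespace PrivPST

/-! ### Differential privacy -/

/-- One of the two datasets is obtained by inserting one tuple into the other. -/
def Neighboring {α : Type*} (D D' : Multiset α) : Prop :=
  ∃ s : α, D = s ::ₘ D' ∨ D' = s ::ₘ D

/-- A randomized algorithm `M` (its output law on each dataset) is `ε`-differentially private on
the datasets whose tuples all satisfy `P`. The case `S = {O}` is the bound
`ln (Pr[M D = O] / Pr[M D' = O]) ≤ ε` for a single output `O`. -/
def IsDP {α Ω : Type*} [MeasurableSpace Ω] (ε : ℝ) (P : α → Prop)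
    (M : Multiset α → Measure Ω) : Prop :=
  ∀ D D' : Multiset α, (∀ s ∈ D, P s) → (∀ s ∈ D', P s) → Neighboring D D' →
    ∀ S : Set Ω, MeasurableSet S → M D S ≤ ENNReal.ofReal (Real.exp ε) * M D' S

/-! ### Laplace noise -/

/-- The Laplace distribution of scale `b`: density `exp (-|x| / b) / (2 b)` when `0 < b`
(and, by convention, the point mass at `0` otherwise). -/
def laplace (b : ℝ) : Measure ℝ :=
  if 0 < b then
    volume.withDensity fun x => ENNReal.ofReal (1 / (2 * b) * Real.exp (-|x| / b))
  else Measure.dirac 0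

instance (b : ℝ) : IsProbabilityMeasure (laplace b) := by
  unfold laplace
  split_ifs with hb
  · have h1 : ∫ x : ℝ, 1 / (2 * b) * Real.exp (-|x| / b) = 1 := by
      rw [integral_comp_abs (f := fun x => 1 / (2 * b) * Real.exp (-x / b)),
        integral_const_mul]
      have h2 : ∫ x : ℝ in Set.Ioi 0, Real.exp (-x / b) = b := by
        have h3 := integral_exp_mul_Ioi (a := -(1 / b)) (by simpa using hb) 0
        have h4 : (fun x : ℝ => Real.exp (-x / b)) = fun x => Real.exp (-(1 / b) * x) := by
          funext x
          congr 1
          ring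
        rw [h4, h3]
        simp
      rw [h2]
      field_simp
    have hI : Integrable (fun x : ℝ => 1 / (2 * b) * Real.exp (-|x| / b)) :=
      Integrable.of_integral_ne_zero (by rw [h1]; exact one_ne_zero)
    constructor
    rw [withDensity_apply _ MeasurableSet.univ, Measure.restrict_univ,
      ← ofReal_integral_eq_lintegral_ofReal hI, h1, ENNReal.ofReal_one]
    exact Filter.Eventually.of_forall fun x => by positivity
  · infer_instance

/-! ### Sequences and prediction histograms -/

/-- A sequence `$ x₁ ⋯ xₗ &` over the alphabet `I`, or, if `closed = false`, an open-ended
(truncated) sequence `$ x₁ ⋯ xₗ` without the end marker `&`. -/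
structure Sequence (I : Type*) where
  items : List I
  closed : Bool

variable {I : Type*}

/-- The symbols after the start marker `$`. They lie in `I ∪ {&}`; here `none` is `&`. -/
def Sequence.symbols (s : Sequence I) : List (Option I) :=
  s.items.map some ++ if s.closed then [none] else []

/-- The length of a sequence, counting `&` (if present) but not `$`. -/
def Sequence.length (s : Sequence I) : ℕ := s.symbols.length

/-- The part of a sequence that precedes `s.symbols[i]`. It consists of symbols in `I ∪ {$}`;
here `none` is `$`. -/
def Sequence.before (s : Sequence I) (i : ℕ) : List (Option I) :=
  none :: (s.items.take i).map some

/-- A node of a prediction suffix tree, given by its predictor string over `I ∪ {$}`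
(`none` is `$`). The root is `[]`, the children of `v` are the strings `a :: v`, and the depth
of `v` is the length of `v`. -/
abbrev Node (I : Type*) := List (Option I)

open scoped Classical in
/-- The number of occurrences of the string `v` in `s` that are immediately followed by the
symbol `x ∈ I ∪ {&}` (`none` is `&`). -/
def Sequence.occ (s : Sequence I) (v : Node I) (x : Option I) : ℕ :=
  ((Finset.range s.length).filter fun i => v <:+ s.before i ∧ s.symbols[i]? = some x).card

/-- The prediction histogram of the node `v` on the dataset `D`. -/
def hist (D : Multiset (Sequence I)) (v : Node I) (x : Option I) : ℕ :=
  (D.map fun s => s.occ v x).sum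

/-- The score of `v`: the magnitude of its histogram minus the largest count. -/
def score [Fintype I] (D : Multiset (Sequence I)) (v : Node I) : ℝ :=
  ((∑ x : Option I, hist D v x : ℕ) : ℝ) - ((Finset.univ.sup (hist D v) : ℕ) : ℝ)

/-! ### The algorithm -/

/-- The biased score of `v`. -/
def biased [Fintype I] (D : Multiset (Sequence I)) (θ δ : ℝ) (v : Node I) : ℝ :=
  max (score D v - (v.length : ℝ) * δ) (θ - δ)

/-- The nodes created by a run in which visiting the node `v` draws the noise `η v`: the root
is created, and a visited node `v` is split (all of its `|I| + 1` children are created) when its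
noisy biased score exceeds `θ`. A node whose string starts with `$` cannot be split. -/
inductive Created [Fintype I] (D : Multiset (Sequence I)) (θ δ : ℝ) (η : Node I → ℝ) :
    Node I → Prop
  | root : Created D θ δ η []
  | child (v : Node I) (a : Option I) (hv : Created D θ δ η v) (hC : v.head? ≠ some none)
      (hsplit : θ < biased D θ δ v + η v) : Created D θ δ η (a :: v)

/-- The tree returned by a run: the set of all created nodes, with all scores and histograms
removed. -/
def outputTree [Fintype I] (D : Multiset (Sequence I)) (θ δ : ℝ) (η : Node I → ℝ) :
    Set (Node I) :=
  {v | Created D θ δ η v}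

/-- The law of the output of PrivTree on prediction suffix trees, where the noise of each node
is drawn independently from the Laplace distribution of scale `lam`. -/
def privTree [Fintype I] (lam θ δ : ℝ) (D : Multiset (Sequence I)) : Measure (Set (Node I)) :=
  (Measure.infinitePi fun _ : Node I => laplace lam).map (outputTree D θ δ)

theorem measurable_outputTree [Fintype I] (D : Multiset (Sequence I)) (θ δ : ℝ) :
    Measurable (outputTree D θ δ) := by
  refine measurable_set_iff.2 fun v => ?_
  induction v with
  | nil =>
    have : (fun η => ([] : Node I) ∈ outputTree D θ δ η) = fun _ => True := by
      funext η
      exact eq_true Created.root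
    rw [this]
    exact measurable_const
  | cons a v ih =>
    have : (fun η => (a :: v : Node I) ∈ outputTree D θ δ η) = fun η =>
        v ∈ outputTree D θ δ η ∧ v.head? ≠ some none ∧ θ < biased D θ δ v + η v := by
      funext η
      refine propext ⟨fun h => ?_, fun h => Created.child v a h.1 h.2.1 h.2.2⟩
      cases h with
      | child _ _ hv hC hs => exact ⟨hv, hC, hs⟩
    rw [this]
    refine ih.and (measurable_const.and ?_)
    exact measurableSet_setOfPred.1
      (measurableSet_lt measurable_const ((measurable_pi_apply v).const_add _))

instance [Fintype I] (lam θ δ : ℝ) (D : Multiset (Sequence I)) :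
    IsProbabilityMeasure (privTree lam θ δ D) :=
  Measure.isProbabilityMeasure_map (measurable_outputTree D θ δ).aemeasurable

end PrivPST

end

open MeasureTheory

noncomputable section

namespace PrivPST

/-! ### Tails of the Laplace distribution -/

/-! The inserted sequence is added one symbol occurrence at a time, and each occurrence costs at
most a factor `exp (κ / lam)`, where `κ = 1 + 1 / (1 - exp (-L))` and `δ = lam * L`. For `L = log β`
this `κ` is `(2β - 1) / (β - 1)`, so at most `lmax` occurrences cost at most `exp ε`.

One occurrence at position `j` changes counts only at the suffixes of `s.before j`, a single root
path, and there changes each score by 0 or 1 (`scoreOf_insert`). Split the probability space by the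
depth at which the decisions on this path first fail. Given that depth, the tree depends only on
noise off the path, which is independent and sees the same scores in both datasets. It thus suffices
to compare the probabilities of each first-failure depth (`infinitePi_grow_le`).

These are products of success probabilities and at most one failure probability. Raising scores
helps successes and hurts failures. In one direction only the failure factor matters, and it costs
`exp (1 / lam)`. In the other, the logarithms of the success ratios are summed along an arbitrarily
long path. Scores do not increase with depth and the bias subtracts `δ` per level, so the normalized
scores are spaced by at least `L`. The log-tail has slope 0 below the cutoff `-L`, slope 1 on `[-L,
0)`, which contains at most one point, and slope at most `exp (-t)` above 0, which gives a geometric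
series. The total slope is at most `κ`, whatever the depth. -/

/-- The probability that standard Laplace noise exceeds `-t`. -/
def laplaceTail (t : ℝ) : ℝ :=
  if t ≤ 0 then Real.exp t / 2 else 1 - Real.exp (-t) / 2

theorem laplaceTail_pos (t : ℝ) : 0 < laplaceTail t := by
  unfold laplaceTail
  split_ifs with h
  · positivity
  · have : Real.exp (-t) ≤ 1 := Real.exp_le_one_iff.2 (by linarith)
    linarith

theorem laplaceTail_mono : Monotone laplaceTail := by
  intro x y hxy
  unfold laplaceTail
  split_ifs with hx hy hy
  · linarith [Real.exp_le_exp.2 hxy]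
  · have h1 : Real.exp x ≤ 1 := Real.exp_le_one_iff.2 hx
    have h2 : Real.exp (-y) ≤ 1 := Real.exp_le_one_iff.2 (by linarith)
    linarith
  · linarith
  · linarith [Real.exp_le_exp.2 (neg_le_neg hxy)]

theorem laplaceTail_neg (t : ℝ) : laplaceTail (-t) = 1 - laplaceTail t := by
  unfold laplaceTail
  rcases lt_trichotomy t 0 with h | rfl | h
  · rw [if_neg (by linarith), if_pos h.le, neg_neg]
  · norm_num
  · rw [if_pos (by linarith), if_neg (by linarith)]
    ring

theorem continuous_laplaceTail : Continuous laplaceTail := by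
  unfold laplaceTail
  refine Continuous.if_le (by fun_prop) (by fun_prop) continuous_id continuous_const ?_
  rintro x rfl
  norm_num

/-- For `t ≥ 0` the slope is `(exp (-t) / 2) / (1 - exp (-t) / 2)`, whose denominator is at least
`1/2`. One-sided derivatives are enough for the mean value inequality and survive the later
truncation. -/
theorem hasDerivWithinAt_log_laplaceTail (t : ℝ) :
    ∃ d ≤ (if t < 0 then 1 else Real.exp (-t)),
      HasDerivWithinAt (fun x => Real.log (laplaceTail x)) d (Set.Ici t) t := by
  have hpos := laplaceTail_pos t
  by_cases h : t < 0
  · refine ⟨1, by rw [if_pos h], HasDerivAt.hasDerivWithinAt ?_⟩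
    have h1 : HasDerivAt (fun x : ℝ => x - Real.log 2) 1 t := (hasDerivAt_id t).sub_const _
    refine h1.congr_of_eventuallyEq ?_
    filter_upwards [Iio_mem_nhds h] with x hx
    rw [laplaceTail, if_pos (le_of_lt hx), Real.log_div (Real.exp_ne_zero _) two_ne_zero,
      Real.log_exp]
  · have h0 : 0 ≤ t := not_lt.1 h
    have he : Real.exp (-t) ≤ 1 := Real.exp_le_one_iff.2 (by linarith)
    have hne : (1 - Real.exp (-t) / 2) ≠ 0 := by linarith
    have h1 : HasDerivAt (fun x : ℝ => Real.log (1 - Real.exp (-x) / 2))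
        ((-(Real.exp (-t) * (-1) / 2)) / (1 - Real.exp (-t) / 2)) t := by
      have h2 := (((hasDerivAt_id t).neg.exp.div_const 2).const_sub 1).log hne
      simpa using h2
    refine ⟨_, ?_, h1.hasDerivWithinAt.congr ?_ ?_⟩
    · rw [if_neg h, div_le_iff₀ (by linarith)]
      nlinarith [Real.exp_pos (-t)]
    · intro x hx
      have hx : t ≤ x := hx
      rw [laplaceTail]
      split_ifs with h3
      · obtain rfl : x = 0 := by linarith
        norm_num
      · rfl
    · rw [laplaceTail]
      split_ifs with h3
      · obtain rfl : t = 0 := by linarith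
        norm_num
      · rfl

theorem continuous_log_laplaceTail : Continuous fun x => Real.log (laplaceTail x) :=
  continuous_laplaceTail.log fun x => (laplaceTail_pos x).ne'

/-! ### Total logarithmic loss along a path -/

/-- A mean value inequality for finite sums of functions with bounded right derivatives. -/
theorem sum_sub_le_of_hasDerivWithinAt_Ici {ψ h : ℝ → ℝ} (hψ : Continuous ψ)
    (hd : ∀ t, ∃ d ≤ h t, HasDerivWithinAt ψ d (Set.Ici t) t) (J : Finset ℕ) (t : ℕ → ℝ)
    {s κ : ℝ} (hs : 0 ≤ s) (hκ : ∀ u, ∑ i ∈ J, h (t i + u) ≤ κ) :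
    ∑ i ∈ J, (ψ (t i + s) - ψ (t i)) ≤ κ * s := by
  choose d hdle hder using hd
  have key := image_le_of_deriv_right_le_deriv_boundary
    (f := fun u => ∑ i ∈ J, ψ (t i + u)) (f' := fun u => ∑ i ∈ J, d (t i + u))
    (a := 0) (b := s) (B := fun u => ∑ i ∈ J, ψ (t i) + κ * u) (B' := fun _ => κ)
    (by fun_prop)
    (fun x _ => by
      refine HasDerivWithinAt.fun_sum fun i _ => ?_
      have h1 : HasDerivWithinAt (fun u => t i + u) 1 (Set.Ici x) x :=
        ((hasDerivAt_id x).const_add (t i)).hasDerivWithinAt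
      have h2 := (hder (t i + x)).comp x h1 (fun u hu => by
        have hu : x ≤ u := hu
        show t i + x ≤ t i + u
        linarith)
      simpa [Function.comp_def] using h2)
    (by simp) (by fun_prop)
    (fun x _ => by
      have h1 : HasDerivAt (fun u => ∑ i ∈ J, ψ (t i) + κ * u) κ x := by
        simpa using ((hasDerivAt_id x).const_mul κ).const_add (∑ i ∈ J, ψ (t i))
      exact h1.hasDerivWithinAt)
    (fun x _ => (Finset.sum_le_sum fun i _ => hdle _).trans (hκ x))
    (Set.right_mem_Icc.2 hs)
  rw [Finset.sum_sub_distrib]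
  linarith

theorem laplaceTail_add_le (t : ℝ) {s : ℝ} (hs : 0 ≤ s) :
    laplaceTail (t + s) ≤ Real.exp s * laplaceTail t := by
  have h := sum_sub_le_of_hasDerivWithinAt_Ici (h := fun _ => 1) continuous_log_laplaceTail
    (fun t => by
      obtain ⟨d, hd, h⟩ := hasDerivWithinAt_log_laplaceTail t
      refine ⟨d, hd.trans ?_, h⟩
      split_ifs with h0
      · exact le_rfl
      · exact Real.exp_le_one_iff.2 (by linarith)) {0} (fun _ => t) hs (κ := 1) (by simp)
  rw [Finset.sum_singleton] at h
  rw [← Real.exp_log (laplaceTail_pos (t + s)), ← Real.exp_log (laplaceTail_pos t),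
    ← Real.exp_add, Real.exp_le_exp]
  linarith

/-- A bound on the derivative of the logarithm of the Laplace tail, truncated at `-L`. -/
def slopeBound (L t : ℝ) : ℝ :=
  if t < -L then 0 else if t < 0 then 1 else Real.exp (-t)

/-- The truncation creates a kink at `-L`; there the right derivative is that of the untruncated
function. -/
theorem hasDerivWithinAt_log_laplaceTail_max (L t : ℝ) :
    ∃ d ≤ slopeBound L t,
      HasDerivWithinAt (fun x => Real.log (laplaceTail (max x (-L)))) d (Set.Ici t) t := by
  unfold slopeBound
  by_cases h : t < -L
  · refine ⟨0, by rw [if_pos h], HasDerivAt.hasDerivWithinAt ?_⟩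
    refine (hasDerivAt_const t (Real.log (laplaceTail (-L)))).congr_of_eventuallyEq ?_
    filter_upwards [Iio_mem_nhds h] with x hx
    rw [max_eq_right (le_of_lt hx)]
  · rw [if_neg h]
    obtain ⟨d, hd, h1⟩ := hasDerivWithinAt_log_laplaceTail t
    refine ⟨d, hd, h1.congr (fun x hx => ?_) ?_⟩
    · rw [max_eq_left ((not_lt.1 h).trans hx)]
    · rw [max_eq_left (not_lt.1 h)]

/-- Going back from the last point, the terms `exp (-t i)` shrink by at least `exp (-L)` per step: a
geometric series. -/
theorem sum_slopeBound_le_exp {L : ℝ} (hL : 0 < L) {t : ℕ → ℝ} (ht : ∀ i, t (i + 1) + L ≤ t i)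
    (n : ℕ) (hn : 0 ≤ t n) :
    ∑ i ∈ Finset.range (n + 1), slopeBound L (t i) ≤
      Real.exp (-t n) * (1 / (1 - Real.exp (-L))) := by
  have hq : 0 < 1 - Real.exp (-L) := by
    have : Real.exp (-L) < 1 := Real.exp_lt_one_iff.2 (by linarith)
    linarith
  have hval : ∀ x, 0 ≤ x → slopeBound L x = Real.exp (-x) := fun x hx => by
    rw [slopeBound, if_neg (by linarith), if_neg (by linarith)]
  induction n with
  | zero =>
    rw [Finset.sum_range_one, hval _ hn]
    refine le_mul_of_one_le_right (Real.exp_pos _).le ?_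
    rw [le_div_iff₀ hq]
    linarith [Real.exp_pos (-L)]
  | succ n ih =>
    have h1 := ht n
    rw [Finset.sum_range_succ, hval _ hn]
    have h2 := ih (by linarith)
    have h3 : Real.exp (-t n) ≤ Real.exp (-t (n + 1)) * Real.exp (-L) := by
      rw [← Real.exp_add]
      exact Real.exp_le_exp.2 (by linarith)
    have h4 := mul_le_mul_of_nonneg_right h3 (one_div_pos.2 hq).le
    refine (add_le_add_left (h2.trans h4) _).trans (le_of_eq ?_)
    field_simp
    ring

theorem sum_slopeBound_le {L : ℝ} (hL : 0 < L) {t : ℕ → ℝ} (ht : ∀ i, t (i + 1) + L ≤ t i)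
    (n : ℕ) :
    ∑ i ∈ Finset.range n, slopeBound L (t i) ≤ 1 + 1 / (1 - Real.exp (-L)) := by
  have hq : 0 < 1 / (1 - Real.exp (-L)) := by
    have : Real.exp (-L) < 1 := Real.exp_lt_one_iff.2 (by linarith)
    exact one_div_pos.2 (by linarith)
  have hnn : ∀ n, 0 ≤ t n → ∑ i ∈ Finset.range (n + 1), slopeBound L (t i) ≤
      1 / (1 - Real.exp (-L)) := fun n hn =>
    (sum_slopeBound_le_exp hL ht n hn).trans
      (mul_le_of_le_one_left hq.le (Real.exp_le_one_iff.2 (by linarith)))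
  induction n with
  | zero =>
    rw [Finset.range_zero, Finset.sum_empty]
    linarith
  | succ n ih =>
    by_cases h0 : 0 ≤ t n
    · linarith [hnn n h0]
    by_cases h1 : t n < -L
    · rw [Finset.sum_range_succ, slopeBound, if_pos h1]
      linarith
    · rw [Finset.sum_range_succ, slopeBound, if_neg h1, if_pos (not_le.1 h0)]
      cases n with
      | zero =>
        rw [Finset.range_zero, Finset.sum_empty]
        linarith
      -- The point `t (n + 1)` lies in `[-L, 0)`, so by the spacing all earlier points are
      -- nonnegative and the geometric bound covers them.
      | succ n =>
        have := ht n
        linarith [hnn n (by linarith)]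

/-- The total logarithmic loss of the tail probabilities along a path whose scores decay by at least `L`. -/
theorem sum_log_laplaceTail_sub_le {L s : ℝ} (hL : 0 < L) (hs : 0 ≤ s) {t t' : ℕ → ℝ}
    (ht : ∀ i, t' (i + 1) + L ≤ t' i) (htt : ∀ i, t' i ≤ t i + s) (n : ℕ) :
    ∑ i ∈ Finset.range n, (Real.log (laplaceTail (max (t' i) (-L))) -
      Real.log (laplaceTail (max (t i) (-L)))) ≤ (1 + 1 / (1 - Real.exp (-L))) * s := by
  -- Interpolating from `t' - s` rather than from `t` keeps the spacing `L` at every intermediate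
  -- time. Monotonicity then replaces `t' - s` by `t`.
  have h := sum_sub_le_of_hasDerivWithinAt_Ici (h := slopeBound L)
    (continuous_log_laplaceTail.comp (continuous_id.max continuous_const))
    (hasDerivWithinAt_log_laplaceTail_max L) (Finset.range n) (fun i => t' i - s) hs
    (fun u => sum_slopeBound_le hL (t := fun i => t' i - s + u)
      (fun i => by linarith [ht i]) n)
  refine (Finset.sum_le_sum fun i _ => ?_).trans h
  have h1 : Real.log (laplaceTail (max (t' i - s) (-L))) ≤
      Real.log (laplaceTail (max (t i) (-L))) :=
    Real.log_le_log (laplaceTail_pos _)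
      (laplaceTail_mono (max_le_max_right _ (by linarith [htt i])))
  simp only [Function.comp_apply, id, sub_add_cancel]
  linarith

/-! ### Probabilities of single split decisions -/

theorem laplace_Ioi {b c : ℝ} (hb : 0 < b) (hc : 0 ≤ c) :
    laplace b (Set.Ioi c) = ENNReal.ofReal (laplaceTail (-c / b)) := by
  have hneg : -(1 / b) < 0 := by simpa using hb
  have hEq : Set.EqOn (fun x : ℝ => 1 / (2 * b) * Real.exp (-|x| / b))
      (fun x => 1 / (2 * b) * Real.exp (-(1 / b) * x)) (Set.Ioi c) := fun x hx => by
    have hx : c < x := hx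
    simp only [abs_of_pos (hc.trans_lt hx)]
    congr 2
    ring
  have hI : IntegrableOn (fun x : ℝ => 1 / (2 * b) * Real.exp (-(1 / b) * x)) (Set.Ioi c) :=
    (integrableOn_exp_mul_Ioi hneg c).const_mul _
  rw [laplace, if_pos hb, withDensity_apply _ measurableSet_Ioi,
    ← ofReal_integral_eq_lintegral_ofReal (hI.congr_fun hEq.symm measurableSet_Ioi)
      (Filter.Eventually.of_forall fun x => by positivity),
    setIntegral_congr_fun measurableSet_Ioi hEq, integral_const_mul, integral_exp_mul_Ioi hneg,
    laplaceTail, if_pos (div_nonpos_of_nonpos_of_nonneg (by linarith) hb.le)]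
  congr 1
  rw [show -(1 / b) * c = -c / b by ring]
  field_simp

theorem laplace_Iic {b c : ℝ} (hb : 0 < b) (hc : c ≤ 0) :
    laplace b (Set.Iic c) = ENNReal.ofReal (laplaceTail (c / b)) := by
  have hpos : 0 < 1 / b := by simpa using hb
  have hEq : Set.EqOn (fun x : ℝ => 1 / (2 * b) * Real.exp (-|x| / b))
      (fun x => 1 / (2 * b) * Real.exp ((1 / b) * x)) (Set.Iic c) := fun x hx => by
    have hx : x ≤ c := hx
    simp only [abs_of_nonpos (hx.trans hc)]
    congr 2
    ring
  have hI : IntegrableOn (fun x : ℝ => 1 / (2 * b) * Real.exp ((1 / b) * x)) (Set.Iic c) :=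
    (integrableOn_exp_mul_Iic hpos c).const_mul _
  rw [laplace, if_pos hb, withDensity_apply _ measurableSet_Iic,
    ← ofReal_integral_eq_lintegral_ofReal (hI.congr_fun hEq.symm measurableSet_Iic)
      (Filter.Eventually.of_forall fun x => by positivity),
    setIntegral_congr_fun measurableSet_Iic hEq, integral_const_mul, integral_exp_mul_Iic hpos,
    laplaceTail, if_pos (div_nonpos_of_nonpos_of_nonneg hc hb.le)]
  congr 1
  rw [show (1 / b) * c = c / b by ring]
  field_simp

theorem laplace_success {b : ℝ} (hb : 0 < b) (θ x : ℝ) :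
    laplace b {y | θ < x + y} = ENNReal.ofReal (laplaceTail ((x - θ) / b)) := by
  have hset : {y : ℝ | θ < x + y} = Set.Ioi (θ - x) := by
    ext y
    simp [sub_lt_iff_lt_add']
  rw [hset]
  rcases le_total 0 (θ - x) with h | h
  · rw [laplace_Ioi hb h, neg_sub]
  · rw [← Set.compl_Iic, prob_compl_eq_one_sub measurableSet_Iic, laplace_Iic hb h,
      ← ENNReal.ofReal_one, ← ENNReal.ofReal_sub _ (laplaceTail_pos _).le, ← laplaceTail_neg,
      ← neg_div, neg_sub]

theorem laplace_failure {b : ℝ} (hb : 0 < b) (θ x : ℝ) :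
    laplace b {y | ¬ θ < x + y} = ENNReal.ofReal (laplaceTail (-((x - θ) / b))) := by
  have hm : MeasurableSet {y : ℝ | θ < x + y} :=
    measurableSet_lt measurable_const (measurable_id.const_add x)
  rw [← Set.compl_ofPred, prob_compl_eq_one_sub hm, laplace_success hb, laplaceTail_neg,
    ENNReal.ofReal_sub _ (laplaceTail_pos _).le, ENNReal.ofReal_one]

variable {I : Type*}

/-! ### Trees grown from independent split decisions -/

/-- The nodes all of whose proper ancestors can be split and satisfy `B`. -/
def grow (B : Node I → Prop) : Set (Node I) :=
  {u | ∀ (a : Option I) (v : Node I), (a :: v) <:+ u → v.head? ≠ some none ∧ B v}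

/-- The σ-algebra on `Ω` is left arbitrary so that the one generated by the off-path coordinates can
be used. -/
theorem measurable_grow [Countable I] {Ω : Type*} [MeasurableSpace Ω] {B : Ω → Node I → Prop}
    (hB : ∀ v, Measurable fun ω => B ω v) : Measurable fun ω => grow (B ω) := by
  refine measurable_set_iff.2 fun u => ?_
  exact Measurable.forall fun a => Measurable.forall fun v =>
    measurable_const.imp (measurable_const.and (hB v))

/-- Noise can be assigned to all nodes in advance: a node is created exactly when every decision at
its proper ancestors is positive. -/
theorem outputTree_eq_grow [Fintype I] (D : Multiset (Sequence I)) (θ δ : ℝ) (η : Node I → ℝ) :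
    outputTree D θ δ η = grow fun v => θ < biased D θ δ v + η v := by
  ext u
  constructor
  · intro h
    change Created D θ δ η u at h
    induction h with
    | root => intro a v h; simp at h
    | child v a hv hC hs ih =>
      intro a' v' h
      rcases List.suffix_cons_iff.1 h with h | h
      · obtain ⟨rfl, rfl⟩ := List.cons.inj h
        exact ⟨hC, hs⟩
      · exact ih a' v' h
  · intro h
    change Created D θ δ η u
    induction u with
    | nil => exact .root
    | cons a v ih =>
      obtain ⟨h1, h2⟩ := h a v List.suffix_rfl
      exact .child v a (ih fun a' v' h' => h a' v' (h'.trans (List.suffix_cons a v))) h1 h2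

/-! ### First failure along a path, and independence -/

/-- The noise values for which the path of split decisions first fails at depth `n`, as a
condition on the noise of the node of depth `i` with score `x`. -/
def cut (θ x : ℝ) (i n : ℕ) : Set ℝ :=
  if i < n then {y | θ < x + y} else if i = n then {y | ¬ θ < x + y} else Set.univ

theorem measurableSet_cut (θ x : ℝ) (i n : ℕ) : MeasurableSet (cut θ x i n) := by
  have hm : MeasurableSet {y : ℝ | θ < x + y} :=
    measurableSet_lt measurable_const (measurable_id.const_add x)
  unfold cut
  split_ifs
  · exact hm
  · exact hm.compl
  · exact .univ

/-- The σ-algebra generated by the coordinates in `s`. -/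
@[reducible]
def coordAlgebra {ι : Type*} (X : Type*) [MeasurableSpace X] (s : Set ι) :
    MeasurableSpace (ι → X) :=
  ⨆ i ∈ s, MeasurableSpace.comap (fun η : ι → X => η i) inferInstance

theorem measurable_coordAlgebra {ι X : Type*} [MeasurableSpace X] {s : Set ι} {i : ι}
    (hi : i ∈ s) : Measurable[coordAlgebra X s] fun η : ι → X => η i :=
  (comap_measurable _).mono (le_iSup₂ (f := fun i (_ : i ∈ s) =>
    MeasurableSpace.comap (fun η : ι → X => η i) inferInstance) i hi) le_rfl

theorem indep_coordAlgebra {ι X : Type*} [MeasurableSpace X] (μ : ι → Measure X)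
    [∀ i, IsProbabilityMeasure (μ i)] {s t : Set ι} (hst : Disjoint s t) :
    ProbabilityTheory.Indep (coordAlgebra X s) (coordAlgebra X t) (Measure.infinitePi μ) := by
  have hind : ProbabilityTheory.iIndepFun (fun i (η : ι → X) => η i) (Measure.infinitePi μ) :=
    ProbabilityTheory.iIndepFun_infinitePi (P := μ) (X := fun _ x => x) fun _ => measurable_id
  exact ProbabilityTheory.indep_iSup_of_disjoint (fun i => (measurable_pi_apply i).comap_le)
    hind.iIndep hst

/-- Coordinates in a finite set are independent of the other coordinates. -/
theorem infinitePi_pi_inter {ι X : Type*} [MeasurableSpace X] (μ : ι → Measure X)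
    [∀ i, IsProbabilityMeasure (μ i)] (F : Finset ι) {t : ι → Set X}
    (mt : ∀ i, MeasurableSet (t i)) {R : Set (ι → X)}
    (hR : MeasurableSet[coordAlgebra X (F : Set ι)ᶜ] R) :
    Measure.infinitePi μ (Set.pi F t ∩ R) =
      Measure.infinitePi μ (Set.pi F t) * Measure.infinitePi μ R := by
  refine (ProbabilityTheory.Indep_iff _ _ _).1
    (indep_coordAlgebra μ (s := (F : Set ι)) disjoint_compl_right) _ _ ?_ hR
  rw [Set.pi_def]
  exact @MeasurableSet.biInter _ _ (coordAlgebra X (F : Set ι)) _ _ F.countable_toSet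
    fun i hi => measurable_coordAlgebra hi (mt i)

open scoped Classical in
/-- The nodes on the path from the root to `w`. -/
def pathTo (w : Node I) : Finset (Node I) := w.tails.toFinset

theorem mem_pathTo {v w : Node I} : v ∈ pathTo w ↔ v <:+ w := by
  simp [pathTo]

theorem prod_pathTo {M : Type*} [CommMonoid M] (w : Node I) (f : Node I → M) :
    ∏ v ∈ pathTo w, f v = ∏ i ∈ Finset.range (w.length + 1), f (w.rtake i) := by
  symm
  refine Finset.prod_bij (fun i _ => w.rtake i) (fun i _ => ?_) (fun i hi j hj h => ?_)
    (fun v hv => ?_) (fun i _ => rfl)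
  · exact mem_pathTo.2 (List.drop_suffix _ _)
  · have := congrArg List.length h
    simp only [List.rtake, List.length_drop, Finset.mem_range] at this hi hj
    omega
  · have h := mem_pathTo.1 hv
    exact ⟨v.length, Finset.mem_range.2 (Nat.lt_succ_of_le h.length_le),
      (List.suffix_iff_eq_drop.1 h).symm⟩

/-- The event that the path of split decisions towards `w` first fails at depth `n`. -/
def firstFail (w : Node I) (b : Node I → ℝ) (θ : ℝ) (n : ℕ) : Set (Node I → ℝ) :=
  Set.pi (pathTo w) fun v => cut θ (b v) v.length n

theorem measurableSet_firstFail (w : Node I) (b : Node I → ℝ) (θ : ℝ) (n : ℕ) :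
    MeasurableSet (firstFail w b θ n) :=
  MeasurableSet.pi (Finset.countable_toSet _) fun _ _ => measurableSet_cut _ _ _ _

theorem mem_firstFail {w : Node I} {b : Node I → ℝ} {θ : ℝ} {n : ℕ} {η : Node I → ℝ} :
    η ∈ firstFail w b θ n ↔ ∀ v, v <:+ w →
      (v.length < n → θ < b v + η v) ∧ (v.length = n → ¬ θ < b v + η v) := by
  simp only [firstFail, Set.mem_pi, SetLike.mem_coe, mem_pathTo]
  refine forall₂_congr fun v _ => ?_
  unfold cut
  split_ifs with h1 h2
  · simp [h1, h1.ne]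
  · simp [h2]
  · simp [h1, h2]

theorem exists_mem_firstFail (w : Node I) (b : Node I → ℝ) (θ : ℝ) (η : Node I → ℝ) :
    ∃ n ∈ Finset.range (w.length + 2), η ∈ firstFail w b θ n := by
  classical
  -- The value `w.length + 1` encodes that no decision on the path fails.
  have hex : ∃ n, n = w.length + 1 ∨ ∃ v, v <:+ w ∧ v.length = n ∧ ¬ θ < b v + η v :=
    ⟨_, Or.inl rfl⟩
  have hle : Nat.find hex ≤ w.length + 1 := Nat.find_min' hex (Or.inl rfl)
  refine ⟨Nat.find hex, Finset.mem_range.2 (by omega), mem_firstFail.2 fun v hv => ⟨?_, ?_⟩⟩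
  · intro h
    by_contra hθ
    exact Nat.find_min hex h (Or.inr ⟨v, hv, rfl, hθ⟩)
  · intro h
    rcases Nat.find_spec hex with h1 | ⟨v', hv', hl, hθ⟩
    · have := hv.length_le
      omega
    · rwa [(List.suffix_of_suffix_length_le hv hv' (by omega)).eq_of_length (by omega)]

theorem disjoint_firstFail (w : Node I) (b : Node I → ℝ) (θ : ℝ) :
    Set.PairwiseDisjoint (Finset.range (w.length + 2) : Set ℕ) (firstFail w b θ) := by
  have key : ∀ m n, m < n → n < w.length + 2 →
      Disjoint (firstFail w b θ m) (firstFail w b θ n) := by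
    intro m n hmn hn
    refine Set.disjoint_left.2 fun η h1 h2 => ?_
    have hl : (w.rtake m).length = m := by
      simp only [List.rtake, List.length_drop]
      omega
    have hs : w.rtake m <:+ w := List.drop_suffix _ _
    exact (mem_firstFail.1 h1 _ hs).2 hl ((mem_firstFail.1 h2 _ hs).1 (hl.trans_lt hmn))
  intro m hm n hn hmn
  simp only [Finset.coe_range, Set.mem_Iio] at hm hn
  rcases lt_or_gt_of_ne hmn with h | h
  · exact key m n h hn
  · exact (key n m h hm).symm

open scoped Classical in
/-- The tree grown when the split decisions on the path to `w` are forced to first fail at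
depth `n`. -/
def forcedTree (w : Node I) (b : Node I → ℝ) (θ : ℝ) (n : ℕ) (η : Node I → ℝ) : Set (Node I) :=
  grow fun v => if v <:+ w then v.length < n else θ < b v + η v

/-- Decisions below the first failure are irrelevant, because nothing below that node on the path is
created; they may be replaced by failures. -/
theorem grow_eq_forcedTree {w : Node I} {b : Node I → ℝ} {θ : ℝ} {n : ℕ} {η : Node I → ℝ}
    (h : η ∈ firstFail w b θ n) : (grow fun v => θ < b v + η v) = forcedTree w b θ n η := by
  rw [mem_firstFail] at h
  ext u
  constructor
  · intro hu a v hv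
    refine ⟨(hu a v hv).1, ?_⟩
    beta_reduce
    split_ifs with hw
    · by_contra hlt
      have hl : (v.rtake n).length = n := by
        simp only [List.rtake, List.length_drop]
        omega
      obtain ⟨p, hp⟩ : v.rtake n <:+ v := List.drop_suffix _ _
      -- Here `x :: v.rtake n` is the child, towards `u`, of the path node that fails.
      obtain ⟨q, x, hx⟩ := (List.eq_nil_or_concat (a :: p)).resolve_left (List.cons_ne_nil a p)
      have hsuf : x :: v.rtake n <:+ u := by
        refine List.IsSuffix.trans ⟨q, ?_⟩ hv
        rw [← hp, ← List.cons_append, hx]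
        simp [hp]
      exact (h _ ((List.drop_suffix _ _).trans hw)).2 hl (hu x _ hsuf).2
    · exact (hu a v hv).2
  · intro hu a v hv
    obtain ⟨h1, h2⟩ := hu a v hv
    refine ⟨h1, ?_⟩
    split_ifs at h2 with hw
    · exact (h v hw).1 h2
    · exact h2

theorem measurableSet_forcedTree [Countable I] (w : Node I) (b : Node I → ℝ) (θ : ℝ) (n : ℕ)
    {S : Set (Set (Node I))} (hS : MeasurableSet S) :
    MeasurableSet[coordAlgebra ℝ (pathTo w : Set (Node I))ᶜ] {η | forcedTree w b θ n η ∈ S} := by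
  refine @measurable_grow I _ _ (coordAlgebra ℝ (pathTo w : Set (Node I))ᶜ) _ (fun v => ?_) S hS
  by_cases hv : v <:+ w
  · simp only [if_pos hv]
    exact measurable_const
  · simp only [if_neg hv]
    have h1 : MeasurableSet {y : ℝ | θ < b v + y} :=
      measurableSet_lt measurable_const (measurable_id.const_add _)
    exact (measurableSet_setOfPred.1 h1).comp
      (measurable_coordAlgebra (by simpa [mem_pathTo] using hv))

/-- Two families of scores that differ only along one path give comparable trees as soon as the
probabilities of the depth of the first failure on this path are comparable. -/
theorem infinitePi_grow_le [Countable I] (μ : Measure ℝ) [IsProbabilityMeasure μ] (w : Node I)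
    {b b' : Node I → ℝ} (θ : ℝ) (K : ENNReal) (hoff : ∀ v, ¬ v <:+ w → b v = b' v)
    (hK : ∀ n, ∏ i ∈ Finset.range (w.length + 1), μ (cut θ (b (w.rtake i)) i n) ≤
      K * ∏ i ∈ Finset.range (w.length + 1), μ (cut θ (b' (w.rtake i)) i n))
    {S : Set (Set (Node I))} (hS : MeasurableSet S) :
    Measure.infinitePi (fun _ : Node I => μ) {η | (grow fun v => θ < b v + η v) ∈ S} ≤
      K * Measure.infinitePi (fun _ : Node I => μ) {η | (grow fun v => θ < b' v + η v) ∈ S} := by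
  set P := Measure.infinitePi (fun _ : Node I => μ) with hP
  have hforced : ∀ n, forcedTree w b θ n = forcedTree w b' θ n := fun n => by
    funext η
    unfold forcedTree
    congr 1
    funext v
    split_ifs with hv
    · rfl
    · rw [hoff v hv]
  have hE : ∀ (c : Node I → ℝ) n, P (firstFail w c θ n) =
      ∏ i ∈ Finset.range (w.length + 1), μ (cut θ (c (w.rtake i)) i n) := fun c n => by
    rw [hP, firstFail, Measure.infinitePi_pi _ fun _ _ => measurableSet_cut _ _ _ _, prod_pathTo]
    refine Finset.prod_congr rfl fun i hi => ?_
    have hl : (w.rtake i).length = i := by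
      simp only [List.rtake, List.length_drop, Finset.mem_range] at hi ⊢
      omega
    rw [hl]
  have hinter : ∀ (c : Node I → ℝ) n,
      P (firstFail w c θ n ∩ {η | (grow fun v => θ < c v + η v) ∈ S}) =
        P (firstFail w c θ n) * P {η | forcedTree w c θ n η ∈ S} := fun c n => by
    rw [hP, firstFail, ← infinitePi_pi_inter (fun _ : Node I => μ) (pathTo w)
      (fun v => measurableSet_cut θ (c v) v.length n) (measurableSet_forcedTree w c θ n hS)]
    congr 1
    ext η
    refine and_congr_right fun h : η ∈ firstFail w c θ n => ?_
    rw [Set.mem_ofPred_eq, Set.mem_ofPred_eq, grow_eq_forcedTree h]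
  have hmeas : MeasurableSet {η : Node I → ℝ | (grow fun v => θ < b' v + η v) ∈ S} :=
    measurable_grow (fun v => measurableSet_setOfPred.1
      (measurableSet_lt measurable_const ((measurable_pi_apply v).const_add _))) hS
  calc P {η | (grow fun v => θ < b v + η v) ∈ S}
      ≤ P (⋃ n ∈ Finset.range (w.length + 2),
          firstFail w b θ n ∩ {η | (grow fun v => θ < b v + η v) ∈ S}) := by
        refine measure_mono fun η hη => ?_
        obtain ⟨n, hn, h⟩ := exists_mem_firstFail w b θ η
        exact Set.mem_iUnion₂.2 ⟨n, hn, h, hη⟩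
    _ ≤ ∑ n ∈ Finset.range (w.length + 2),
          P (firstFail w b θ n ∩ {η | (grow fun v => θ < b v + η v) ∈ S}) :=
        measure_biUnion_finset_le _ _
    _ ≤ ∑ n ∈ Finset.range (w.length + 2),
          K * P (firstFail w b' θ n ∩ {η | (grow fun v => θ < b' v + η v) ∈ S}) := by
        refine Finset.sum_le_sum fun n _ => ?_
        rw [hinter, hinter, hE, hE, hforced, ← mul_assoc]
        exact mul_le_mul_left (hK n) _
    _ = K * P (⋃ n ∈ Finset.range (w.length + 2),
          firstFail w b' θ n ∩ {η | (grow fun v => θ < b' v + η v) ∈ S}) := by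
        rw [← Finset.mul_sum, measure_biUnion_finset]
        · exact (disjoint_firstFail w b' θ).mono fun n => Set.inter_subset_left
        · exact fun n _ => (measurableSet_firstFail w b' θ n).inter hmeas
    _ ≤ K * P {η | (grow fun v => θ < b' v + η v) ∈ S} := by
        refine mul_le_mul_right (measure_mono ?_) _
        exact Set.iUnion₂_subset fun n _ => Set.inter_subset_right

/-! ### Inserting one symbol occurrence -/

/-- The score of a node with respect to arbitrary prediction histograms. -/
def scoreOf [Fintype I] (h : Node I → Option I → ℕ) (v : Node I) : ℝ :=
  ((∑ x, h v x : ℕ) : ℝ) - ((Finset.univ.sup (h v) : ℕ) : ℝ)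

/-- The biased score of a node with respect to arbitrary prediction histograms. -/
def biasedOf [Fintype I] (h : Node I → Option I → ℕ) (θ δ : ℝ) (v : Node I) : ℝ :=
  max (scoreOf h v - (v.length : ℝ) * δ) (θ - δ)

/-- If `m` is a mode of `h v`, the score of `v` is the sum of its counts off `m`. This dominates the
same sum for `u`, which is at least the score of `u`. -/
theorem scoreOf_le_scoreOf [Fintype I] {h : Node I → Option I → ℕ} {u v : Node I}
    (hle : ∀ x, h u x ≤ h v x) : scoreOf h u ≤ scoreOf h v := by
  obtain ⟨m, -, hm⟩ := Finset.exists_mem_eq_sup Finset.univ Finset.univ_nonempty (h v)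
  have h1 : h u m ≤ Finset.univ.sup (h u) := Finset.le_sup (Finset.mem_univ m)
  have h2 : ∑ x, h u x + h v m ≤ ∑ x, h v x + h u m := by
    classical
    rw [← Finset.add_sum_erase _ (h u) (Finset.mem_univ m),
      ← Finset.add_sum_erase _ (h v) (Finset.mem_univ m)]
    have := Finset.sum_le_sum fun x (_ : x ∈ Finset.univ.erase m) => hle x
    omega
  have h3 : ∑ x, h u x + h v m ≤ ∑ x, h v x + Finset.univ.sup (h u) := by omega
  have h4 : ((∑ x, h u x : ℕ) : ℝ) + (h v m : ℝ) ≤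
      ((∑ x, h v x : ℕ) : ℝ) + ((Finset.univ.sup (h u) : ℕ) : ℝ) := by exact_mod_cast h3
  rw [scoreOf, scoreOf, hm]
  linarith

theorem scoreOf_insert [Fintype I] [DecidableEq (Option I)] {h h' : Node I → Option I → ℕ}
    {v : Node I} {x₀ : Option I} (hh : ∀ x, h' v x = h v x + if x = x₀ then 1 else 0) :
    scoreOf h v ≤ scoreOf h' v ∧ scoreOf h' v ≤ scoreOf h v + 1 := by
  have hsum : ∑ x, h' v x = ∑ x, h v x + 1 := by
    simp [hh, Finset.sum_add_distrib]
  have h1 : Finset.univ.sup (h v) ≤ Finset.univ.sup (h' v) :=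
    Finset.sup_mono_fun fun x _ => by rw [hh]; exact Nat.le_add_right _ _
  have h2 : Finset.univ.sup (h' v) ≤ Finset.univ.sup (h v) + 1 :=
    Finset.sup_le fun x hx => by
      have := Finset.le_sup (f := h v) hx
      rw [hh]
      split_ifs <;> omega
  have h1' : ((Finset.univ.sup (h v) : ℕ) : ℝ) ≤ ((Finset.univ.sup (h' v) : ℕ) : ℝ) := by
    exact_mod_cast h1
  have h2' : ((Finset.univ.sup (h' v) : ℕ) : ℝ) ≤ ((Finset.univ.sup (h v) : ℕ) : ℝ) + 1 := by
    exact_mod_cast h2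
  rw [scoreOf, scoreOf, hsum]
  push_cast
  constructor <;> linarith

/-- For a success the factor is the exact ratio; a failure only becomes less likely, and the factor
is at least 1. -/
theorem laplace_cut_le_of_le {lam : ℝ} (hlam : 0 < lam) (θ : ℝ) {x x' : ℝ} (hx : x ≤ x')
    (i n : ℕ) :
    laplace lam (cut θ x' i n) ≤ ENNReal.ofReal (Real.exp
      (Real.log (laplaceTail ((x' - θ) / lam)) - Real.log (laplaceTail ((x - θ) / lam)))) *
      laplace lam (cut θ x i n) := by
  have hle : laplaceTail ((x - θ) / lam) ≤ laplaceTail ((x' - θ) / lam) :=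
    laplaceTail_mono (by gcongr)
  have h1 : 1 ≤ ENNReal.ofReal (Real.exp
      (Real.log (laplaceTail ((x' - θ) / lam)) - Real.log (laplaceTail ((x - θ) / lam)))) := by
    rw [ENNReal.one_le_ofReal, Real.one_le_exp_iff, sub_nonneg]
    exact Real.log_le_log (laplaceTail_pos _) hle
  unfold cut
  split_ifs
  · rw [laplace_success hlam, laplace_success hlam, ← ENNReal.ofReal_mul (Real.exp_pos _).le,
      Real.exp_sub, Real.exp_log (laplaceTail_pos _), Real.exp_log (laplaceTail_pos _),
      div_mul_cancel₀ _ (laplaceTail_pos _).ne']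
  · refine le_mul_of_one_le_of_le h1 (measure_mono fun y hy => ?_)
    have hy : ¬ θ < x' + y := hy
    show ¬ θ < x + y
    linarith
  · exact le_mul_of_one_le_left' h1

theorem laplace_cut_le_of_ge {lam : ℝ} (hlam : 0 < lam) (θ : ℝ) {x x' : ℝ} (hx : x ≤ x')
    (hx' : x' ≤ x + 1) (i n : ℕ) :
    laplace lam (cut θ x i n) ≤
      (if i = n then ENNReal.ofReal (Real.exp (1 / lam)) else 1) *
        laplace lam (cut θ x' i n) := by
  unfold cut
  split_ifs with h1 h2 h2
  · omega
  · rw [one_mul]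
    refine measure_mono fun y hy => ?_
    have hy : θ < x + y := hy
    show θ < x' + y
    linarith
  · rw [laplace_failure hlam, laplace_failure hlam, ← ENNReal.ofReal_mul (Real.exp_pos _).le]
    refine ENNReal.ofReal_le_ofReal (le_trans (laplaceTail_mono ?_)
      (laplaceTail_add_le _ (one_div_pos.2 hlam).le))
    rw [← neg_div, ← neg_div, ← add_div]
    gcongr
    linarith
  · rw [one_mul]

/-- Inserting one occurrence of one symbol changes the law of the tree by a bounded factor. -/
theorem infinitePi_grow_insert [Fintype I] [DecidableEq (Option I)] {lam L : ℝ} (θ : ℝ)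
    (hlam : 0 < lam) (hL : 0 < L) {h h' : Node I → Option I → ℕ} {w : Node I} {x₀ : Option I}
    (hon : ∀ v, v <:+ w → ∀ x, h' v x = h v x + if x = x₀ then 1 else 0)
    (hoff : ∀ v, ¬ v <:+ w → h' v = h v)
    (hanti : ∀ u v, v <:+ u → ∀ x, h' u x ≤ h' v x)
    {S : Set (Set (Node I))} (hS : MeasurableSet S) :
    let P := Measure.infinitePi (fun _ : Node I => laplace lam)
    let K := ENNReal.ofReal (Real.exp ((1 + 1 / (1 - Real.exp (-L))) * (1 / lam)))
    P {η | (grow fun v => θ < biasedOf h' θ (lam * L) v + η v) ∈ S} ≤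
        K * P {η | (grow fun v => θ < biasedOf h θ (lam * L) v + η v) ∈ S} ∧
      P {η | (grow fun v => θ < biasedOf h θ (lam * L) v + η v) ∈ S} ≤
        K * P {η | (grow fun v => θ < biasedOf h' θ (lam * L) v + η v) ∈ S} := by
  intro P K
  have hoff' : ∀ v, ¬ v <:+ w → biasedOf h θ (lam * L) v = biasedOf h' θ (lam * L) v :=
    fun v hv => by simp only [biasedOf, scoreOf, hoff v hv]
  have hsuf : ∀ i, w.rtake i <:+ w := fun i => List.drop_suffix _ _
  have hb : ∀ i, biasedOf h θ (lam * L) (w.rtake i) ≤ biasedOf h' θ (lam * L) (w.rtake i) :=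
    fun i => max_le_max_right _
      (sub_le_sub_right (scoreOf_insert (h' := h') (hon _ (hsuf i))).1 _)
  have hb' : ∀ i, biasedOf h' θ (lam * L) (w.rtake i) ≤
      biasedOf h θ (lam * L) (w.rtake i) + 1 := fun i => by
    have h1 := (scoreOf_insert (h := h) (h' := h') (hon _ (hsuf i))).2
    unfold biasedOf
    refine max_le ?_ ?_
    · linarith [le_max_left (scoreOf h (w.rtake i) - ((w.rtake i).length : ℝ) * (lam * L))
        (θ - lam * L)]
    · linarith [le_max_right (scoreOf h (w.rtake i) - ((w.rtake i).length : ℝ) * (lam * L))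
        (θ - lam * L)]
  refine ⟨infinitePi_grow_le _ w θ K (fun v hv => (hoff' v hv).symm) (fun n => ?_) hS,
    infinitePi_grow_le _ w θ K hoff' (fun n => ?_) hS⟩
  · refine (Finset.prod_le_prod' fun i _ => laplace_cut_le_of_le hlam θ (hb i) i n).trans ?_
    rw [Finset.prod_mul_distrib, ← ENNReal.ofReal_prod_of_nonneg fun i _ => (Real.exp_pos _).le,
      ← Real.exp_sum]
    refine mul_le_mul_left (ENNReal.ofReal_le_ofReal (Real.exp_le_exp.2 ?_)) _
    -- Since `δ = lam * L`, normalization turns the cutoff `θ - δ` into `-L`.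
    have hdiv : ∀ (g : Node I → Option I → ℕ), ∀ i ∈ Finset.range (w.length + 1),
        (biasedOf g θ (lam * L) (w.rtake i) - θ) / lam =
          max ((scoreOf g (w.rtake i) - i * (lam * L) - θ) / lam) (-L) := fun g i hi => by
      have hl : (w.rtake i).length = i := by
        simp only [List.rtake, List.length_drop, Finset.mem_range] at hi ⊢
        omega
      rw [biasedOf, hl, ← max_sub_sub_right, ← max_div_div_right hlam.le]
      congr 1
      field_simp
      ring
    rw [Finset.sum_congr rfl fun i hi => by rw [hdiv h i hi, hdiv h' i hi]]
    refine sum_log_laplaceTail_sub_le hL (one_div_pos.2 hlam).le (fun i => ?_) (fun i => ?_) _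
    · have h1 : w.rtake i <:+ w.rtake (i + 1) :=
        List.suffix_of_suffix_length_le (hsuf i) (hsuf (i + 1)) (by
          simp only [List.rtake, List.length_drop]
          omega)
      have h2 := scoreOf_le_scoreOf (hanti _ _ h1)
      rw [div_add' _ _ _ hlam.ne']
      gcongr
      push_cast
      linarith
    · have h1 := (scoreOf_insert (h := h) (h' := h') (hon _ (hsuf i))).2
      rw [← add_div]
      gcongr
      linarith
  · refine (Finset.prod_le_prod' fun i _ =>
      laplace_cut_le_of_ge hlam θ (hb i) (hb' i) i n).trans ?_
    rw [Finset.prod_mul_distrib]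
    refine mul_le_mul_left ?_ _
    have hq : 0 < 1 / (1 - Real.exp (-L)) := by
      have : Real.exp (-L) < 1 := Real.exp_lt_one_iff.2 (by linarith)
      exact one_div_pos.2 (by linarith)
    have hK : ENNReal.ofReal (Real.exp (1 / lam)) ≤ K :=
      ENNReal.ofReal_le_ofReal (Real.exp_le_exp.2
        (le_mul_of_one_le_left (one_div_pos.2 hlam).le (by linarith)))
    -- Only the failure at depth `n` contributes; the product is 1 if `n` exceeds the path length.
    rw [Finset.prod_ite_eq']
    split_ifs
    · exact hK
    · refine le_trans ?_ hK
      rw [ENNReal.one_le_ofReal, Real.one_le_exp_iff]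
      exact (one_div_pos.2 hlam).le

/-! ### Inserting one sequence -/

open scoped Classical in
/-- The prediction histograms of `D` together with the first `j` symbols of `s`. -/
def histWithPrefix (D : Multiset (Sequence I)) (s : Sequence I) (j : ℕ) (v : Node I)
    (x : Option I) : ℕ :=
  hist D v x +
    ((Finset.range j).filter fun i => v <:+ s.before i ∧ s.symbols[i]? = some x).card

theorem histWithPrefix_zero (D : Multiset (Sequence I)) (s : Sequence I) :
    histWithPrefix D s 0 = hist D := by
  funext v x
  simp [histWithPrefix]

theorem histWithPrefix_length (D : Multiset (Sequence I)) (s : Sequence I) :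
    histWithPrefix D s s.length = hist (s ::ₘ D) := by
  funext v x
  simp [histWithPrefix, hist, Sequence.occ, add_comm]

open scoped Classical in
theorem histWithPrefix_anti (D : Multiset (Sequence I)) (s : Sequence I) (j : ℕ) {u v : Node I}
    (huv : v <:+ u) (x : Option I) : histWithPrefix D s j u x ≤ histWithPrefix D s j v x := by
  refine add_le_add ?_ (Finset.card_le_card
    (Finset.monotone_filter_right _ fun i _ h => ⟨huv.trans h.1, h.2⟩))
  refine Multiset.sum_map_le_sum_map _ _ fun s _ => ?_
  exact Finset.card_le_card (Finset.monotone_filter_right _ fun i _ h => ⟨huv.trans h.1, h.2⟩)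

open scoped Classical in
theorem histWithPrefix_succ (D : Multiset (Sequence I)) (s : Sequence I) (j : ℕ) (v : Node I)
    (x : Option I) : histWithPrefix D s (j + 1) v x = histWithPrefix D s j v x +
      if v <:+ s.before j ∧ s.symbols[j]? = some x then 1 else 0 := by
  unfold histWithPrefix
  rw [Finset.range_add_one, Finset.filter_insert]
  split_ifs
  · rw [Finset.card_insert_of_notMem (by simp), add_assoc]
  · rfl

theorem infinitePi_grow_prefix [Fintype I] {lam L : ℝ} (θ : ℝ) (hlam : 0 < lam) (hL : 0 < L)
    (D : Multiset (Sequence I)) (s : Sequence I) {j : ℕ} (hj : j ≤ s.length)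
    {S : Set (Set (Node I))} (hS : MeasurableSet S) :
    let P := Measure.infinitePi (fun _ : Node I => laplace lam)
    let K := ENNReal.ofReal (Real.exp ((1 + 1 / (1 - Real.exp (-L))) * (1 / lam)))
    P {η | (grow fun v => θ < biasedOf (histWithPrefix D s j) θ (lam * L) v + η v) ∈ S} ≤
        K ^ j * P {η | (grow fun v => θ < biasedOf (hist D) θ (lam * L) v + η v) ∈ S} ∧
      P {η | (grow fun v => θ < biasedOf (hist D) θ (lam * L) v + η v) ∈ S} ≤
        K ^ j * P {η | (grow fun v =>
          θ < biasedOf (histWithPrefix D s j) θ (lam * L) v + η v) ∈ S} := by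
  classical
  intro P K
  induction j with
  | zero => simp [histWithPrefix_zero]
  | succ j ih =>
    obtain ⟨h1, h2⟩ := ih (by omega)
    have hj' : j < s.symbols.length := hj
    -- Symbol `j` adds one occurrence to exactly the suffixes of `s.before j`.
    obtain ⟨h3, h4⟩ := infinitePi_grow_insert (h := histWithPrefix D s j)
      (h' := histWithPrefix D s (j + 1)) (w := s.before j) (x₀ := s.symbols[j]) θ hlam hL
      (fun v hv x => by
        rw [histWithPrefix_succ, List.getElem?_eq_getElem hj']
        simp [hv, eq_comm])
      (fun v hv => by
        funext x
        rw [histWithPrefix_succ]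
        simp [hv])
      (fun u v huv => histWithPrefix_anti D s (j + 1) huv) hS
    constructor
    · refine h3.trans ((mul_le_mul_right h1 _).trans (le_of_eq ?_))
      rw [← mul_assoc, pow_succ']
    · refine h2.trans ((mul_le_mul_right h4 _).trans (le_of_eq ?_))
      rw [← mul_assoc, pow_succ]

theorem privTree_apply [Fintype I] (lam θ δ : ℝ) (D : Multiset (Sequence I))
    {S : Set (Set (Node I))} (hS : MeasurableSet S) :
    privTree lam θ δ D S = Measure.infinitePi (fun _ : Node I => laplace lam)
      {η | (grow fun v => θ < biasedOf (hist D) θ δ v + η v) ∈ S} := by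
  rw [privTree, Measure.map_apply (measurable_outputTree D θ δ) hS]
  congr 1
  ext η
  rw [Set.mem_preimage, outputTree_eq_grow]
  rfl

theorem privTree_cons [Fintype I] {lam L : ℝ} (θ : ℝ) (hlam : 0 < lam) (hL : 0 < L)
    (D : Multiset (Sequence I)) (s : Sequence I) {S : Set (Set (Node I))}
    (hS : MeasurableSet S) :
    let K := ENNReal.ofReal
      (Real.exp (s.length * ((1 + 1 / (1 - Real.exp (-L))) * (1 / lam))))
    privTree lam θ (lam * L) (s ::ₘ D) S ≤ K * privTree lam θ (lam * L) D S ∧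
      privTree lam θ (lam * L) D S ≤ K * privTree lam θ (lam * L) (s ::ₘ D) S := by
  have h := infinitePi_grow_prefix θ hlam hL D s le_rfl hS
  simp only [← ENNReal.ofReal_pow (Real.exp_pos _).le, ← Real.exp_nat_mul,
    histWithPrefix_length] at h
  simpa only [privTree_apply _ _ _ _ hS] using h

theorem privTree_cons_of_length_eq_zero [Fintype I] (lam θ δ : ℝ) (D : Multiset (Sequence I))
    {s : Sequence I} (hs : s.length = 0) : privTree lam θ δ (s ::ₘ D) = privTree lam θ δ D := by
  ext S hS
  have h : hist (s ::ₘ D) = hist D := by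
    rw [← histWithPrefix_length, hs, histWithPrefix_zero]
  rw [privTree_apply _ _ _ _ hS, privTree_apply _ _ _ _ hS, h]

theorem privTree_cons_le [Fintype I] [Nonempty I] {lmax : ℕ} {ε β lam θ δ : ℝ}
    (hε : 0 < ε) (hβ : β = (Fintype.card I : ℝ) + 1)
    (hlam : (2 * β - 1) / (β - 1) * ((lmax : ℝ) / ε) ≤ lam)
    (hδ : δ = lam * Real.log β) (D : Multiset (Sequence I)) {s : Sequence I}
    (hs : s.length ≤ lmax) {S : Set (Set (Node I))} (hS : MeasurableSet S) :
    privTree lam θ δ (s ::ₘ D) S ≤ ENNReal.ofReal (Real.exp ε) * privTree lam θ δ D S ∧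
      privTree lam θ δ D S ≤ ENNReal.ofReal (Real.exp ε) * privTree lam θ δ (s ::ₘ D) S := by
  -- An empty sequence changes no histogram. Otherwise `lmax > 0`, which forces `lam > 0`; so the
  -- noiseless case `lam = 0` arises only here.
  rcases Nat.eq_zero_or_pos s.length with h0 | hpos
  · have h1 : 1 ≤ ENNReal.ofReal (Real.exp ε) := by
      rw [ENNReal.one_le_ofReal, Real.one_le_exp_iff]
      exact hε.le
    rw [privTree_cons_of_length_eq_zero lam θ δ D h0]
    exact ⟨le_mul_of_one_le_left' h1, le_mul_of_one_le_left' h1⟩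
  have hcard : (1 : ℝ) ≤ Fintype.card I := by exact_mod_cast Fintype.card_pos
  have hβ1 : 0 < β - 1 := by linarith
  have hκ : 0 < (2 * β - 1) / (β - 1) := div_pos (by linarith) hβ1
  have hl : (0 : ℝ) < lmax := by exact_mod_cast hpos.trans_le hs
  have hlam0 : 0 < lam := (mul_pos hκ (div_pos hl hε)).trans_le hlam
  have hL : 0 < Real.log β := Real.log_pos (by linarith)
  have hexp : 1 + 1 / (1 - Real.exp (-Real.log β)) = (2 * β - 1) / (β - 1) := by
    rw [Real.exp_neg, Real.exp_log (by linarith)]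
    have h1 : (1 - β⁻¹) = (β - 1) / β := by
      rw [sub_div, div_self (by linarith), one_div]
    rw [h1]
    field_simp
    ring
  have hle : s.length * ((1 + 1 / (1 - Real.exp (-Real.log β))) * (1 / lam)) ≤ ε := by
    rw [hexp]
    have hs' : (s.length : ℝ) ≤ lmax := by exact_mod_cast hs
    rw [← mul_assoc, mul_one_div, div_le_iff₀ hlam0, mul_comm (s.length : ℝ)]
    rw [← mul_div_assoc, div_le_iff₀ hε] at hlam
    exact (mul_le_mul_of_nonneg_left hs' hκ.le).trans (by linarith)
  have hK := ENNReal.ofReal_le_ofReal (Real.exp_le_exp.2 hle)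
  obtain ⟨h1, h2⟩ := privTree_cons θ hlam0 hL D s hS
  rw [hδ]
  exact ⟨h1.trans (mul_le_mul_left hK _), h2.trans (mul_le_mul_left hK _)⟩

end PrivPST

end

theorem mainTheorem5 {I : Type*} [Fintype I] [Nonempty I] (lmax : ℕ) (ε β lam θ δ : ℝ)
    (hε : 0 < ε) (hβ : β = (Fintype.card I : ℝ) + 1)
    (hlam : (2 * β - 1) / (β - 1) * ((lmax : ℝ) / ε) ≤ lam)
    (hδ : δ = lam * Real.log β) :
    PrivPST.IsDP ε (fun s : PrivPST.Sequence I => s.length ≤ lmax)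
      (PrivPST.privTree lam θ δ) := by
  rintro D D' hD hD' ⟨s, rfl | rfl⟩ S hS
  · exact (PrivPST.privTree_cons_le hε hβ hlam hδ D' (hD s (Multiset.mem_cons_self s D')) hS).1
  · exact (PrivPST.privTree_cons_le hε hβ hlam hδ D (hD' s (Multiset.mem_cons_self s D)) hS).2
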